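/- All Hilbert spaces are complex. A CSL on a Hilbert space $H$ is a set $\mathcal L$ of pairwise commuting orthogonal projections on $H$ which contains $0$ and $I$ and is closed under arbitrary suprema and infima; the corresponding CSL algebra is $\mathrm{Alg}(\mathcal L)=\{T\in B(H): TL(H)\subseteq L(H)\ \forall L\in\mathcal L\}$. A masa is a maximal abelian selfadjoint algebra of operators. For a set $\mathcal X$ of operators, $[\mathcal X]$ denotes the weak* closure of its linear span. Two weak* closed algebras $\mathcal A_1\subseteq B(H)$ and $\mathcal A_2\subseteq B(K)$ are called spatially Morita equivalent as algebras if there are subspaces $\mathcal X\subseteq B(K,H)$ and $\mathcal Y\subseteq B(H,K)$ with $\mathcal A_1\mathcal X\mathcal A_2\subseteq\mathcal X$ and $\mathcal A_2\mathcal Y\mathcal A_1\subseteq\mathcal Y$ such that $\mathcal A_1=[\mathcal X\mathcal Y]$ and $\mathcal A_2=[\mathcal Y\mathcal X]$. A subspace $\mathcal U\subseteq B(H_1,H_2)$ is nondegenerate if the linear span of $\mathcal U(H_1)$ is dense in $H_2$ and the linear span of $\mathcal U^*(H_2)$ is dense in $H_1$. If masas $\mathcal D_i$ on $H_i$ and $\mathcal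 E_i$ on $K_i$ ($i=1,2$) are fixed, and $\mathcal U_1\subseteq B(H_1,H_2)$, $\mathcal U_2\subseteq B(K_1,K_2)$ are nondegenerate subspaces with $\mathcal D_2\mathcal U_1\mathcal D_1\subseteq\mathcal U_1$ and $\mathcal E_2\mathcal U_2\mathcal E_1\subseteq\mathcal U_2$, then $\mathcal U_1,\mathcal U_2$ are called spatially Morita equivalent as masa bimodules (over these masas) if there are subspaces $\mathcal V_i\subseteq B(H_i,K_i)$ and $\mathcal W_i\subseteq B(K_i,H_i)$ with $\mathcal E_i\mathcal V_i\mathcal D_i\subseteq\mathcal V_i$ and $\mathcal D_i\mathcal W_i\mathcal E_i\subseteq\mathcal W_i$ ($i=1,2$) such that $\mathcal U_1=[\mathcal W_2\mathcal U_2\mathcal V_1]$, $\mathcal U_2=[\mathcal V_2\mathcal U_1\mathcal W_1]$, and each of $[\mathcal V_1\mathcal W_1]$, $[\mathcal W_1\mathcal V_1]$, $[\mathcal V_2\mathcal W_2]$, $[\mathcal W_2\mathcal V_2]$ is an algebra containing the identity operator. **Proposition.** Let $\mathcal A_1\subseteq B(H)$ and $\mathcal A_2\subseteq B(K)$ be CSL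 algebras. (a) For all masas $\mathcal D_1,\mathcal D_2$ on $H$ and $\mathcal E_1,\mathcal E_2$ on $K$ with $\mathcal D_2\mathcal A_1\mathcal D_1\subseteq\mathcal A_1$ and $\mathcal E_2\mathcal A_2\mathcal E_1\subseteq\mathcal A_2$, the algebras $\mathcal A_1$ and $\mathcal A_2$ are spatially Morita equivalent as algebras if and only if they are spatially Morita equivalent as masa bimodules over these masas. (b) $\mathcal A_1$ and $\mathcal A_2$ are spatially Morita equivalent as algebras if and only if there are masas $\mathcal D_1,\mathcal D_2$ on $H$ and $\mathcal E_1,\mathcal E_2$ on $K$ over which they are spatially Morita equivalent as masa bimodules. -/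

import Mathlib

namespace SpatialMorita

section WeakStar

variable {H₁ : Type*} [NormedAddCommGroup H₁] [InnerProductSpace ℂ H₁]
  {H₂ : Type*} [NormedAddCommGroup H₂] [InnerProductSpace ℂ H₂]

/-- For square-summable sequences `ξ` in `H₁` and `η` in `H₂`, the normal functional
`T ↦ ∑ₙ ⟨η n, T (ξ n)⟩` on `B(H₁, H₂)`; every normal functional has this form. -/
noncomputable def normalFunctional (ξ : lp (fun _ : ℕ => H₁) 2) (η : lp (fun _ : ℕ => H₂) 2)
    (T : H₁ →L[ℂ] H₂) : ℂ :=
  ∑' n, inner ℂ (η n) (T (ξ n))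

/-- The series that defines `normalFunctional` converges for every bounded operator. -/
theorem summable_normalFunctional (ξ : lp (fun _ : ℕ => H₁) 2) (η : lp (fun _ : ℕ => H₂) 2)
    (T : H₁ →L[ℂ] H₂) : Summable fun n => inner ℂ (η n) (T (ξ n)) := by
  have hξ : Summable fun n => ‖ξ n‖ ^ 2 := by
    simpa using (lp.memℓp ξ).summable (by norm_num)
  have hη : Summable fun n => ‖η n‖ ^ 2 := by
    simpa using (lp.memℓp η).summable (by norm_num)
  refine Summable.of_norm_bounded (g := fun n => ‖η n‖ ^ 2 + ‖T‖ ^ 2 * ‖ξ n‖ ^ 2)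
    (hη.add (hξ.mul_left _)) fun n => ?_
  have h1 : ‖inner ℂ (η n) (T (ξ n))‖ ≤ ‖η n‖ * ‖T (ξ n)‖ := norm_inner_le_norm _ _
  have h2 : ‖η n‖ * ‖T (ξ n)‖ ≤ ‖η n‖ * (‖T‖ * ‖ξ n‖) :=
    mul_le_mul_of_nonneg_left (T.le_opNorm _) (norm_nonneg _)
  nlinarith [sq_nonneg (‖η n‖ - ‖T‖ * ‖ξ n‖), sq_nonneg (‖η n‖), sq_nonneg (‖T‖ * ‖ξ n‖)]

/-- The weak* (ultraweak) topology on `B(H₁, H₂)`: the coarsest topology that makes all normal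
functionals continuous. It is not registered as an instance. -/
@[reducible] noncomputable def weakStarTopology (H₁ : Type*) [NormedAddCommGroup H₁]
    [InnerProductSpace ℂ H₁] (H₂ : Type*) [NormedAddCommGroup H₂] [InnerProductSpace ℂ H₂] :
    TopologicalSpace (H₁ →L[ℂ] H₂) :=
  ⨅ (ξ : lp (fun _ : ℕ => H₁) 2) (η : lp (fun _ : ℕ => H₂) 2),
    TopologicalSpace.induced (normalFunctional ξ η) inferInstance

/-- `[X]`: the weak* closure of the linear span of a set of operators. -/
noncomputable def weakStarSpan (X : Set (H₁ →L[ℂ] H₂)) : Set (H₁ →L[ℂ] H₂) :=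
  @closure _ (weakStarTopology H₁ H₂) (Submodule.span ℂ X : Set (H₁ →L[ℂ] H₂))

end WeakStar

/-- The set `X Y = {x ∘ y : x ∈ X, y ∈ Y}` of products of operators. -/
def opMul {H₁ : Type*} [NormedAddCommGroup H₁] [InnerProductSpace ℂ H₁]
    {H₂ : Type*} [NormedAddCommGroup H₂] [InnerProductSpace ℂ H₂]
    {H₃ : Type*} [NormedAddCommGroup H₃] [InnerProductSpace ℂ H₃]
    (X : Set (H₂ →L[ℂ] H₃)) (Y : Set (H₁ →L[ℂ] H₂)) : Set (H₁ →L[ℂ] H₃) :=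
  Set.image2 (fun x y => x ∘L y) X Y

/-- A subspace `X ⊆ B(H₁, H₂)` is a `B`-`A` bimodule (`B` acting on `H₂`, `A` acting on `H₁`)
if `B X A ⊆ X`. -/
def IsBimodule {H₁ : Type*} [NormedAddCommGroup H₁] [InnerProductSpace ℂ H₁]
    {H₂ : Type*} [NormedAddCommGroup H₂] [InnerProductSpace ℂ H₂]
    (B : Set (H₂ →L[ℂ] H₂)) (A : Set (H₁ →L[ℂ] H₁)) (X : Submodule ℂ (H₁ →L[ℂ] H₂)) : Prop :=
  ∀ b ∈ B, ∀ x ∈ X, ∀ a ∈ A, b ∘L x ∘L a ∈ X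

section CSL

variable {H : Type*} [NormedAddCommGroup H] [InnerProductSpace ℂ H] [CompleteSpace H]

/-- A commutative subspace lattice: a commuting set of orthogonal projections containing `0` and
`I` and closed under arbitrary suprema (projections onto the closed span of the ranges) and
arbitrary infima (projections onto the intersection of the ranges, which is already closed). -/
structure IsCSL (L : Set (H →L[ℂ] H)) : Prop where
  isStarProjection : ∀ P ∈ L, IsStarProjection P
  commute : ∀ P ∈ L, ∀ Q ∈ L, P * Q = Q * P
  zero_mem : (0 : H →L[ℂ] H) ∈ L
  one_mem : (1 : H →L[ℂ] H) ∈ L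
  sup_mem : ∀ S ⊆ L, (⨆ P ∈ S, P.range).topologicalClosure.starProjection ∈ L
  inf_mem : ∀ S ⊆ L, (⨅ P ∈ S, P.range).topologicalClosure.starProjection ∈ L

/-- `Alg(L)`: the algebra of all operators `T` with `T L(H) ⊆ L(H)` for every projection in the
given set. -/
def latticeAlg (L : Set (H →L[ℂ] H)) : Subalgebra ℂ (H →L[ℂ] H) where
  carrier := {T | ∀ P ∈ L, ∀ x ∈ P.range, T x ∈ P.range}
  mul_mem' := fun hS hT P hP x hx => hS P hP _ (hT P hP x hx)
  add_mem' := fun hS hT P hP x hx => add_mem (hS P hP x hx) (hT P hP x hx)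
  algebraMap_mem' := fun c P _ x hx => by
    simpa [Algebra.algebraMap_eq_smul_one] using P.range.smul_mem c hx

/-- A CSL algebra is an algebra of the form `Alg(L)` with `L` a CSL. -/
def IsCSLAlgebra (A : Subalgebra ℂ (H →L[ℂ] H)) : Prop :=
  ∃ L : Set (H →L[ℂ] H), IsCSL L ∧ A = latticeAlg L

/-- A masa: a maximal abelian selfadjoint algebra of operators on `H`. -/
def IsMasa (D : StarSubalgebra ℂ (H →L[ℂ] H)) : Prop :=
  Maximal (fun D : StarSubalgebra ℂ (H →L[ℂ] H) => ∀ a ∈ D, ∀ b ∈ D, a * b = b * a) D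

/-- A set of operators on `H` is a unital algebra: it is a subalgebra of `B(H)` containing the
identity operator. -/
def IsUnitalAlgebra (S : Set (H →L[ℂ] H)) : Prop :=
  ∃ B : Subalgebra ℂ (H →L[ℂ] H), (B : Set (H →L[ℂ] H)) = S

end CSL

/-- A space `U ⊆ B(H₁, H₂)` is nondegenerate if `U(H₁)` spans a dense subspace of `H₂` and
`U^*(H₂)` spans a dense subspace of `H₁`. -/
def IsNondegenerate {H₁ : Type*} [NormedAddCommGroup H₁] [InnerProductSpace ℂ H₁]
    [CompleteSpace H₁] {H₂ : Type*} [NormedAddCommGroup H₂] [InnerProductSpace ℂ H₂]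
    [CompleteSpace H₂] (U : Submodule ℂ (H₁ →L[ℂ] H₂)) : Prop :=
  (Submodule.span ℂ {y : H₂ | ∃ T ∈ U, ∃ x : H₁, y = T x}).topologicalClosure = ⊤ ∧
  (Submodule.span ℂ {x : H₁ | ∃ T ∈ U, ∃ y : H₂,
    x = ContinuousLinearMap.adjoint T y}).topologicalClosure = ⊤

/-- Spatial Morita equivalence of algebras `A₁` on `H` and `A₂` on `K`: there are an `A₁`-`A₂`
module `X` and an `A₂`-`A₁` module `Y` with `A₁ = [X Y]` and `A₂ = [Y X]`. -/
def MoritaEquivAlgebras {H : Type*} [NormedAddCommGroup H] [InnerProductSpace ℂ H]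
    {K : Type*} [NormedAddCommGroup K] [InnerProductSpace ℂ K]
    (A₁ : Subalgebra ℂ (H →L[ℂ] H)) (A₂ : Subalgebra ℂ (K →L[ℂ] K)) : Prop :=
  ∃ (X : Submodule ℂ (K →L[ℂ] H)) (Y : Submodule ℂ (H →L[ℂ] K)),
    IsBimodule (A₁ : Set (H →L[ℂ] H)) (A₂ : Set (K →L[ℂ] K)) X ∧
    IsBimodule (A₂ : Set (K →L[ℂ] K)) (A₁ : Set (H →L[ℂ] H)) Y ∧
    (A₁ : Set (H →L[ℂ] H)) = weakStarSpan (opMul (X : Set (K →L[ℂ] H)) (Y : Set (H →L[ℂ] K))) ∧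
    (A₂ : Set (K →L[ℂ] K)) = weakStarSpan (opMul (Y : Set (H →L[ℂ] K)) (X : Set (K →L[ℂ] H)))

/-- Spatial Morita equivalence of masa bimodules `U₁ ⊆ B(H₁, H₂)` and `U₂ ⊆ B(K₁, K₂)`, with
respect to fixed masas `D₁, D₂, E₁, E₂` acting on `H₁, H₂, K₁, K₂`. -/
structure MoritaEquivMasaBimodules
    {H₁ : Type*} [NormedAddCommGroup H₁] [InnerProductSpace ℂ H₁] [CompleteSpace H₁]
    {H₂ : Type*} [NormedAddCommGroup H₂] [InnerProductSpace ℂ H₂] [CompleteSpace H₂]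
    {K₁ : Type*} [NormedAddCommGroup K₁] [InnerProductSpace ℂ K₁] [CompleteSpace K₁]
    {K₂ : Type*} [NormedAddCommGroup K₂] [InnerProductSpace ℂ K₂] [CompleteSpace K₂]
    (D₁ : StarSubalgebra ℂ (H₁ →L[ℂ] H₁)) (D₂ : StarSubalgebra ℂ (H₂ →L[ℂ] H₂))
    (E₁ : StarSubalgebra ℂ (K₁ →L[ℂ] K₁)) (E₂ : StarSubalgebra ℂ (K₂ →L[ℂ] K₂))
    (U₁ : Submodule ℂ (H₁ →L[ℂ] H₂)) (U₂ : Submodule ℂ (K₁ →L[ℂ] K₂)) : Prop where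
  masa_D₁ : IsMasa D₁
  masa_D₂ : IsMasa D₂
  masa_E₁ : IsMasa E₁
  masa_E₂ : IsMasa E₂
  bimodule_U₁ : IsBimodule (D₂ : Set (H₂ →L[ℂ] H₂)) (D₁ : Set (H₁ →L[ℂ] H₁)) U₁
  bimodule_U₂ : IsBimodule (E₂ : Set (K₂ →L[ℂ] K₂)) (E₁ : Set (K₁ →L[ℂ] K₁)) U₂
  nondegenerate_U₁ : IsNondegenerate U₁
  nondegenerate_U₂ : IsNondegenerate U₂
  exists_bimodules : ∃ (V₁ : Submodule ℂ (H₁ →L[ℂ] K₁)) (V₂ : Submodule ℂ (H₂ →L[ℂ] K₂))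
      (W₁ : Submodule ℂ (K₁ →L[ℂ] H₁)) (W₂ : Submodule ℂ (K₂ →L[ℂ] H₂)),
    IsBimodule (E₁ : Set (K₁ →L[ℂ] K₁)) (D₁ : Set (H₁ →L[ℂ] H₁)) V₁ ∧
    IsBimodule (E₂ : Set (K₂ →L[ℂ] K₂)) (D₂ : Set (H₂ →L[ℂ] H₂)) V₂ ∧
    IsBimodule (D₁ : Set (H₁ →L[ℂ] H₁)) (E₁ : Set (K₁ →L[ℂ] K₁)) W₁ ∧
    IsBimodule (D₂ : Set (H₂ →L[ℂ] H₂)) (E₂ : Set (K₂ →L[ℂ] K₂)) W₂ ∧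
    (U₁ : Set (H₁ →L[ℂ] H₂)) = weakStarSpan (opMul (W₂ : Set (K₂ →L[ℂ] H₂))
      (opMul (U₂ : Set (K₁ →L[ℂ] K₂)) (V₁ : Set (H₁ →L[ℂ] K₁)))) ∧
    (U₂ : Set (K₁ →L[ℂ] K₂)) = weakStarSpan (opMul (V₂ : Set (H₂ →L[ℂ] K₂))
      (opMul (U₁ : Set (H₁ →L[ℂ] H₂)) (W₁ : Set (K₁ →L[ℂ] H₁)))) ∧
    IsUnitalAlgebra (weakStarSpan (opMul (V₁ : Set (H₁ →L[ℂ] K₁)) (W₁ : Set (K₁ →L[ℂ] H₁)))) ∧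
    IsUnitalAlgebra (weakStarSpan (opMul (W₁ : Set (K₁ →L[ℂ] H₁)) (V₁ : Set (H₁ →L[ℂ] K₁)))) ∧
    IsUnitalAlgebra (weakStarSpan (opMul (V₂ : Set (H₂ →L[ℂ] K₂)) (W₂ : Set (K₂ →L[ℂ] H₂)))) ∧
    IsUnitalAlgebra (weakStarSpan (opMul (W₂ : Set (K₂ →L[ℂ] H₂)) (V₂ : Set (H₂ →L[ℂ] K₂))))

end SpatialMorita

open SpatialMorita

/-! If `A₁ = [X Y]` and `A₂ = [Y X]`, take `V₁ = V₂ = Y` and `W₁ = W₂ = X`: inserting the unital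
algebra `A₂` between `X` and `Y` changes nothing, and masas acting on `Aᵢ` lie in `Aᵢ`, so the
module actions restrict to them. For (b), a masa containing the lattice commutes with it, hence lies
in the CSL algebra.

Conversely, let `A₁ = [W₂ A₂ V₁]` and `A₂ = [V₂ A₁ W₁]`. Then `A₁ = [W₂ V₂ A₁ W₁ V₁]`, and since
`[W₁ V₁]` is an algebra, `A₁ W₁ V₁ ⊆ A₁`; as `1 ∈ A₁`, this gives `W₁ V₁ ⊆ A₁`. Likewise `W₂ V₂ ⊆
A₁` and `Vᵢ Wᵢ ⊆ A₂`. These absorptions force `[A₁ W₁] = [W₂ A₂]` and `[A₂ V₁] = [V₂ A₁]`, which are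
the bimodules `X` and `Y` sought. -/

namespace SpatialMorita

/-! ### Weak* closed spans and separate weak* continuity of composition. -/

section WeakStar

variable {H₁ : Type*} [NormedAddCommGroup H₁] [InnerProductSpace ℂ H₁]
  {H₂ : Type*} [NormedAddCommGroup H₂] [InnerProductSpace ℂ H₂]
  {H₃ : Type*} [NormedAddCommGroup H₃] [InnerProductSpace ℂ H₃]

/-- A normal functional as a linear functional. -/
noncomputable def normalFunctionalₗ (ξ : lp (fun _ : ℕ => H₁) 2) (η : lp (fun _ : ℕ => H₂) 2) :
    (H₁ →L[ℂ] H₂) →ₗ[ℂ] ℂ where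
  toFun := normalFunctional ξ η
  map_add' S T := by
    simp only [normalFunctional, add_apply, inner_add_right]
    exact (summable_normalFunctional ξ η S).tsum_add (summable_normalFunctional ξ η T)
  map_smul' c T := by
    simp only [normalFunctional, smul_apply, inner_smul_right, tsum_mul_left,
      smul_eq_mul, RingHom.id_apply]

theorem continuousAdd_weakStar :
    @ContinuousAdd (H₁ →L[ℂ] H₂) (weakStarTopology H₁ H₂) _ :=
  continuousAdd_iInf fun ξ => continuousAdd_iInf fun η =>
    continuousAdd_induced (normalFunctionalₗ ξ η)

theorem continuousConstSMul_weakStar :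
    @ContinuousConstSMul ℂ (H₁ →L[ℂ] H₂) (weakStarTopology H₁ H₂) _ := by
  have h : @ContinuousSMul ℂ (H₁ →L[ℂ] H₂) _ _ (weakStarTopology H₁ H₂) :=
    continuousSMul_iInf fun ξ => continuousSMul_iInf fun η =>
      continuousSMul_induced (normalFunctionalₗ ξ η)
  let := weakStarTopology H₁ H₂
  exact ContinuousSMul.continuousConstSMul

/-- The weak* closed linear span of a set of operators, as a subspace. -/
noncomputable def weakStarSpanSubmodule (X : Set (H₁ →L[ℂ] H₂)) : Submodule ℂ (H₁ →L[ℂ] H₂) :=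
  @Submodule.topologicalClosure ℂ (H₁ →L[ℂ] H₂) _ (weakStarTopology H₁ H₂) _ _
    continuousConstSMul_weakStar continuousAdd_weakStar (Submodule.span ℂ X)

theorem coe_weakStarSpanSubmodule (X : Set (H₁ →L[ℂ] H₂)) :
    (weakStarSpanSubmodule X : Set (H₁ →L[ℂ] H₂)) = weakStarSpan X := rfl

theorem subset_weakStarSpan (X : Set (H₁ →L[ℂ] H₂)) : X ⊆ weakStarSpan X := fun _ hx =>
  @subset_closure _ (weakStarTopology H₁ H₂) _ _ (Submodule.subset_span hx)

/-- A weak* continuous linear map that sends `X` into `[Z]` sends `[X]` into `[Z]`. -/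
theorem map_mem_weakStarSpan
    {H₄ : Type*} [NormedAddCommGroup H₄] [InnerProductSpace ℂ H₄]
    {X : Set (H₁ →L[ℂ] H₂)} {Z : Set (H₃ →L[ℂ] H₄)}
    (f : (H₁ →L[ℂ] H₂) →ₗ[ℂ] (H₃ →L[ℂ] H₄))
    (hf : @Continuous _ _ (weakStarTopology H₁ H₂) (weakStarTopology H₃ H₄) f)
    (h : ∀ x ∈ X, f x ∈ weakStarSpan Z) {x : H₁ →L[ℂ] H₂} (hx : x ∈ weakStarSpan X) :
    f x ∈ weakStarSpan Z := by
  have hspan : Submodule.span ℂ X ≤ (weakStarSpanSubmodule Z).comap f :=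
    Submodule.span_le.2 h
  let := weakStarTopology H₁ H₂
  let := weakStarTopology H₃ H₄
  have hc : IsClosed (weakStarSpan Z) := isClosed_closure
  exact closure_minimal (fun y hy => hspan hy) (hc.preimage hf) hx

theorem weakStarSpan_subset {X Z : Set (H₁ →L[ℂ] H₂)} (h : X ⊆ weakStarSpan Z) :
    weakStarSpan X ⊆ weakStarSpan Z := fun _ hx =>
  map_mem_weakStarSpan LinearMap.id (@continuous_id _ (weakStarTopology H₁ H₂)) h hx

/-- The image of a square-summable sequence under a bounded operator. -/
noncomputable def lpMap (A : H₁ →L[ℂ] H₂) (ξ : lp (fun _ : ℕ => H₁) 2) :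
    lp (fun _ : ℕ => H₂) 2 :=
  ⟨fun n => A (ξ n), by
    have hξ : Summable fun n => ‖ξ n‖ ^ 2 := by
      simpa using (lp.memℓp ξ).summable (by norm_num)
    refine memℓp_gen ?_
    simp only [ENNReal.toReal_ofNat, Real.rpow_ofNat]
    refine Summable.of_nonneg_of_le (fun n => by positivity) (fun n => ?_)
      (hξ.mul_left (‖A‖ ^ 2))
    rw [← mul_pow]
    exact pow_le_pow_left₀ (norm_nonneg _) (A.le_opNorm _) 2⟩

/-- The weak* topology is initial for the normal functionals, so continuity only requires that each
of them pull back to a normal functional. -/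
theorem continuous_weakStar_of_normalFunctional
    {H₄ : Type*} [NormedAddCommGroup H₄] [InnerProductSpace ℂ H₄]
    (f : (H₁ →L[ℂ] H₂) → (H₃ →L[ℂ] H₄))
    (h : ∀ ξ η, ∃ ξ' η', ∀ T, normalFunctional ξ η (f T) = normalFunctional ξ' η' T) :
    @Continuous _ _ (weakStarTopology H₁ H₂) (weakStarTopology H₃ H₄) f := by
  let := weakStarTopology H₁ H₂
  refine continuous_iInf_rng.2 fun ξ => continuous_iInf_rng.2 fun η => continuous_induced_rng.2 ?_
  obtain ⟨ξ', η', h'⟩ := h ξ η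
  rw [show normalFunctional ξ η ∘ f = normalFunctional ξ' η' from funext h']
  exact continuous_iff_le_induced.2 ((iInf_le _ ξ').trans (iInf_le _ η'))

theorem continuous_weakStar_comp_right (A : H₁ →L[ℂ] H₂) :
    @Continuous _ _ (weakStarTopology H₂ H₃) (weakStarTopology H₁ H₃) (fun T => T ∘L A) :=
  continuous_weakStar_of_normalFunctional _ fun ξ η => ⟨lpMap A ξ, η, fun _ => rfl⟩

/-- The operator `B` moves across the inner product to act on `η` as its adjoint; this is where
completeness enters. -/
theorem continuous_weakStar_comp_left [CompleteSpace H₂] [CompleteSpace H₃] (B : H₂ →L[ℂ] H₃) :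
    @Continuous _ _ (weakStarTopology H₁ H₂) (weakStarTopology H₁ H₃) (fun T => B ∘L T) :=
  continuous_weakStar_of_normalFunctional _ fun ξ η =>
    ⟨ξ, lpMap (ContinuousLinearMap.adjoint B) η, fun T => by
      simp [normalFunctional, lpMap, ContinuousLinearMap.adjoint_inner_left]⟩

theorem comp_mem_weakStarSpan_of_left {X : Set (H₂ →L[ℂ] H₃)} {Z : Set (H₁ →L[ℂ] H₃)}
    {y : H₁ →L[ℂ] H₂} (h : ∀ x ∈ X, x ∘L y ∈ weakStarSpan Z) {x : H₂ →L[ℂ] H₃}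
    (hx : x ∈ weakStarSpan X) : x ∘L y ∈ weakStarSpan Z :=
  map_mem_weakStarSpan
    { toFun := fun T : H₂ →L[ℂ] H₃ => T ∘L y
      map_add' := fun _ _ => rfl
      map_smul' := fun _ _ => rfl }
    (continuous_weakStar_comp_right y) h hx

theorem comp_mem_weakStarSpan_of_right [CompleteSpace H₂] [CompleteSpace H₃]
    {Y : Set (H₁ →L[ℂ] H₂)} {Z : Set (H₁ →L[ℂ] H₃)}
    {x : H₂ →L[ℂ] H₃} (h : ∀ y ∈ Y, x ∘L y ∈ weakStarSpan Z) {y : H₁ →L[ℂ] H₂}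
    (hy : y ∈ weakStarSpan Y) : x ∘L y ∈ weakStarSpan Z :=
  map_mem_weakStarSpan
    { toFun := fun T : H₁ →L[ℂ] H₂ => x ∘L T
      map_add' := fun S T => by ext; simp
      map_smul' := fun c T => by ext; simp }
    (continuous_weakStar_comp_left x) h hy

/-- If `X Y ⊆ [Z]`, then `[X] [Y] ⊆ [Z]`. -/
theorem comp_mem_weakStarSpan [CompleteSpace H₂] [CompleteSpace H₃]
    {X : Set (H₂ →L[ℂ] H₃)} {Y : Set (H₁ →L[ℂ] H₂)} {Z : Set (H₁ →L[ℂ] H₃)}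
    (h : ∀ x ∈ X, ∀ y ∈ Y, x ∘L y ∈ weakStarSpan Z) {x : H₂ →L[ℂ] H₃} {y : H₁ →L[ℂ] H₂}
    (hx : x ∈ weakStarSpan X) (hy : y ∈ weakStarSpan Y) : x ∘L y ∈ weakStarSpan Z :=
  comp_mem_weakStarSpan_of_right
    (fun y hy => comp_mem_weakStarSpan_of_left (fun x hx => h x hx y hy) hx) hy

/-- Serves to expand a middle factor of a product while the outer factors stay fixed. -/
theorem comp_comp_mem_weakStarSpan [CompleteSpace H₂] [CompleteSpace H₃]
    {H₄ : Type*} [NormedAddCommGroup H₄] [InnerProductSpace ℂ H₄] [CompleteSpace H₄]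
    {Y : Set (H₂ →L[ℂ] H₃)} {Z : Set (H₁ →L[ℂ] H₄)} {x : H₃ →L[ℂ] H₄} {z : H₁ →L[ℂ] H₂}
    (h : ∀ y ∈ Y, x ∘L y ∘L z ∈ weakStarSpan Z) {y : H₂ →L[ℂ] H₃}
    (hy : y ∈ weakStarSpan Y) : x ∘L y ∘L z ∈ weakStarSpan Z :=
  map_mem_weakStarSpan
    { toFun := fun T : H₂ →L[ℂ] H₃ => x ∘L T ∘L z
      map_add' := fun S T => by ext; simp
      map_smul' := fun c T => by ext; simp }
    (@Continuous.comp _ _ _ (weakStarTopology H₂ H₃) (weakStarTopology H₁ H₃)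
      (weakStarTopology H₁ H₄) _ _ (continuous_weakStar_comp_left x)
      (continuous_weakStar_comp_right z)) h hy

end WeakStar

/-! ### Masas inside CSL algebras. -/

section Masa

variable {H : Type*} [NormedAddCommGroup H] [InnerProductSpace ℂ H] [CompleteSpace H]

theorem comm_of_mem_adjoin {L : Set (H →L[ℂ] H)} (hL : ∀ P ∈ L, ∀ Q ∈ L, P * Q = Q * P)
    (hL' : ∀ P ∈ L, ∀ Q ∈ L, P * star Q = star Q * P) :
    ∀ a ∈ StarAlgebra.adjoin ℂ L, ∀ b ∈ StarAlgebra.adjoin ℂ L, a * b = b * a := by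
  have := StarAlgebra.isMulCommutative_adjoin ℂ hL hL'
  intro a ha b hb
  exact congrArg Subtype.val
    (this.is_comm.comm (⟨a, ha⟩ : StarAlgebra.adjoin ℂ L) ⟨b, hb⟩)

/-- Every commuting set of selfadjoint operators is contained in a masa. -/
theorem exists_isMasa_of_commute (L : Set (H →L[ℂ] H)) (hsa : ∀ P ∈ L, IsSelfAdjoint P)
    (hL : ∀ P ∈ L, ∀ Q ∈ L, P * Q = Q * P) :
    ∃ D : StarSubalgebra ℂ (H →L[ℂ] H), IsMasa D ∧ L ⊆ D := by
  have hadj := comm_of_mem_adjoin hL fun a ha b hb => by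
    rw [(hsa b hb).star_eq]
    exact hL a ha b hb
  have hub : ∀ c ⊆ {D : StarSubalgebra ℂ (H →L[ℂ] H) | ∀ a ∈ D, ∀ b ∈ D, a * b = b * a},
      IsChain (· ≤ ·) c → ∀ D ∈ c,
      ∃ ub ∈ {D : StarSubalgebra ℂ (H →L[ℂ] H) | ∀ a ∈ D, ∀ b ∈ D, a * b = b * a},
        ∀ E ∈ c, E ≤ ub := by
    intro c hc hchain D hDc
    have hdir : ∀ a b, a ∈ ⋃ E ∈ c, (E : Set (H →L[ℂ] H)) → b ∈ ⋃ E ∈ c, (E : Set (H →L[ℂ] H)) →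
        ∃ E ∈ c, a ∈ E ∧ b ∈ E := by
      intro a b ha hb
      simp only [Set.mem_iUnion, SetLike.mem_coe, exists_prop] at ha hb
      obtain ⟨E, hE, haE⟩ := ha
      obtain ⟨F, hF, hbF⟩ := hb
      obtain ⟨G, hG, hEG, hFG⟩ := hchain.directedOn E hE F hF
      exact ⟨G, hG, hEG haE, hFG hbF⟩
    -- Any two elements of the union of a chain lie in a common member, so the union commutes,
    -- together with its adjoints, and so does the star algebra it generates.
    refine ⟨StarAlgebra.adjoin ℂ (⋃ E ∈ c, (E : Set (H →L[ℂ] H))),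
      comm_of_mem_adjoin (fun a ha b hb => ?_) fun a ha b hb => ?_, fun E hE =>
      (Set.subset_biUnion_of_mem (u := fun E : StarSubalgebra ℂ (H →L[ℂ] H) =>
        (E : Set (H →L[ℂ] H))) hE).trans (StarAlgebra.subset_adjoin ℂ _)⟩
    · obtain ⟨E, hE, haE, hbE⟩ := hdir a b ha hb
      exact hc hE a haE b hbE
    · obtain ⟨E, hE, haE, hbE⟩ := hdir a b ha hb
      exact hc hE a haE (star b) (star_mem hbE)
  obtain ⟨D, hLD, hD⟩ := zorn_le_nonempty₀ _ hub (StarAlgebra.adjoin ℂ L) hadj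
  exact ⟨D, hD, (StarAlgebra.subset_adjoin ℂ L).trans hLD⟩

theorem IsMasa.comm {D : StarSubalgebra ℂ (H →L[ℂ] H)} (hD : IsMasa D) {a b : H →L[ℂ] H}
    (ha : a ∈ D) (hb : b ∈ D) : a * b = b * a := hD.prop a ha b hb

/-- A CSL algebra contains a masa. -/
theorem IsCSLAlgebra.exists_isMasa {A : Subalgebra ℂ (H →L[ℂ] H)} (hA : IsCSLAlgebra A) :
    ∃ D : StarSubalgebra ℂ (H →L[ℂ] H), IsMasa D ∧ ∀ a ∈ D, a ∈ A := by
  obtain ⟨L, hL, rfl⟩ := hA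
  obtain ⟨D, hD, hLD⟩ := exists_isMasa_of_commute L
    (fun P hP => (hL.isStarProjection P hP).isSelfAdjoint) hL.commute
  refine ⟨D, hD, fun a ha P hP x hx => ?_⟩
  obtain ⟨y, rfl⟩ := hx
  -- Since `a` commutes with `P`, `a (P y) = P (a y)`.
  exact ⟨a y, DFunLike.congr_fun (hD.comm (hLD hP) ha) y⟩

end Masa

/-! ### From equivalence of algebras to equivalence of masa bimodules. -/

variable {H : Type*} [NormedAddCommGroup H] [InnerProductSpace ℂ H] [CompleteSpace H]
  {K : Type*} [NormedAddCommGroup K] [InnerProductSpace ℂ K] [CompleteSpace K]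

theorem isBimodule_of_subset {A : Subalgebra ℂ (H →L[ℂ] H)} {D D' : StarSubalgebra ℂ (H →L[ℂ] H)}
    (hD : ∀ a ∈ D, a ∈ A) (hD' : ∀ a ∈ D', a ∈ A) :
    IsBimodule (D : Set (H →L[ℂ] H)) (D' : Set (H →L[ℂ] H)) (Subalgebra.toSubmodule A) :=
  fun b hb _ hx a ha => A.mul_mem (hD b hb) (A.mul_mem hx (hD' a ha))

/-- Put the identity in the other two slots of `D A D' ⊆ A`. -/
theorem mem_left_of_isBimodule {A : Subalgebra ℂ (H →L[ℂ] H)}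
    {D D' : StarSubalgebra ℂ (H →L[ℂ] H)}
    (h : IsBimodule (D : Set (H →L[ℂ] H)) (D' : Set (H →L[ℂ] H)) (Subalgebra.toSubmodule A))
    {a : H →L[ℂ] H} (ha : a ∈ D) : a ∈ A :=
  h a ha 1 (one_mem A) 1 (one_mem D')

theorem mem_right_of_isBimodule {A : Subalgebra ℂ (H →L[ℂ] H)}
    {D D' : StarSubalgebra ℂ (H →L[ℂ] H)}
    (h : IsBimodule (D : Set (H →L[ℂ] H)) (D' : Set (H →L[ℂ] H)) (Subalgebra.toSubmodule A))
    {a : H →L[ℂ] H} (ha : a ∈ D') : a ∈ A :=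
  h 1 (one_mem D) 1 (one_mem A) a ha

theorem isNondegenerate_of_one_mem {U : Submodule ℂ (H →L[ℂ] H)} (h : 1 ∈ U) :
    IsNondegenerate U := by
  constructor
  · rw [show {y : H | ∃ T ∈ U, ∃ x : H, y = T x} = Set.univ from
      Set.eq_univ_of_forall fun y => ⟨1, h, y, rfl⟩]
    exact top_le_iff.1 (Submodule.span_univ.ge.trans (Submodule.le_topologicalClosure _))
  · rw [show {x : H | ∃ T ∈ U, ∃ y : H, x = ContinuousLinearMap.adjoint T y} = Set.univ from
      Set.eq_univ_of_forall fun y => ⟨1, h, y, by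
        rw [← ContinuousLinearMap.star_eq_adjoint, star_one]; rfl⟩]
    exact top_le_iff.1 (Submodule.span_univ.ge.trans (Submodule.le_topologicalClosure _))

/-- If `A₁ = [X Y]` for a right `A₂`-module `X`, then `A₁ = [X A₂ Y]`. -/
theorem eq_weakStarSpan_opMul_opMul {A₁ : Subalgebra ℂ (H →L[ℂ] H)}
    {A₂ : Subalgebra ℂ (K →L[ℂ] K)} {X : Submodule ℂ (K →L[ℂ] H)} {Y : Submodule ℂ (H →L[ℂ] K)}
    (hX : IsBimodule (A₁ : Set (H →L[ℂ] H)) (A₂ : Set (K →L[ℂ] K)) X)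
    (h : (A₁ : Set (H →L[ℂ] H)) = weakStarSpan (opMul (X : Set (K →L[ℂ] H)) (Y : Set (H →L[ℂ] K)))) :
    (A₁ : Set (H →L[ℂ] H)) = weakStarSpan (opMul (X : Set (K →L[ℂ] H))
      (opMul (A₂ : Set (K →L[ℂ] K)) (Y : Set (H →L[ℂ] K)))) := by
  rw [h]
  refine congrArg weakStarSpan (Set.Subset.antisymm ?_ ?_)
  · rintro _ ⟨x, hx, y, hy, rfl⟩
    exact ⟨x, hx, y, ⟨1, one_mem A₂, y, hy, rfl⟩, rfl⟩
  · rintro _ ⟨x, hx, _, ⟨a, ha, y, hy, rfl⟩, rfl⟩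
    exact ⟨x ∘L a, hX 1 (one_mem A₁) x hx a ha, y, hy, rfl⟩

/-- With `V₁ = V₂ = Y` and `W₁ = W₂ = X`, the four required algebras are `A₁` and `A₂` themselves.
-/
theorem MoritaEquivAlgebras.moritaEquivMasaBimodules
    {A₁ : Subalgebra ℂ (H →L[ℂ] H)} {A₂ : Subalgebra ℂ (K →L[ℂ] K)}
    {D₁ D₂ : StarSubalgebra ℂ (H →L[ℂ] H)} {E₁ E₂ : StarSubalgebra ℂ (K →L[ℂ] K)}
    (h : MoritaEquivAlgebras A₁ A₂)
    (hD₁ : IsMasa D₁) (hD₂ : IsMasa D₂) (hE₁ : IsMasa E₁) (hE₂ : IsMasa E₂)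
    (hA₁ : IsBimodule (D₂ : Set (H →L[ℂ] H)) (D₁ : Set (H →L[ℂ] H)) (Subalgebra.toSubmodule A₁))
    (hA₂ : IsBimodule (E₂ : Set (K →L[ℂ] K)) (E₁ : Set (K →L[ℂ] K)) (Subalgebra.toSubmodule A₂)) :
    MoritaEquivMasaBimodules D₁ D₂ E₁ E₂
      (Subalgebra.toSubmodule A₁) (Subalgebra.toSubmodule A₂) := by
  obtain ⟨X, Y, hX, hY, h₁, h₂⟩ := h
  refine ⟨hD₁, hD₂, hE₁, hE₂, hA₁, hA₂, isNondegenerate_of_one_mem (one_mem A₁),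
    isNondegenerate_of_one_mem (one_mem A₂), Y, Y, X, X, ?_, ?_, ?_, ?_,
    eq_weakStarSpan_opMul_opMul hX h₁, eq_weakStarSpan_opMul_opMul hY h₂,
    ⟨A₂, h₂⟩, ⟨A₁, h₁⟩, ⟨A₂, h₂⟩, ⟨A₁, h₁⟩⟩
  · exact fun b hb x hx a ha =>
      hY b (mem_right_of_isBimodule hA₂ hb) x hx a (mem_right_of_isBimodule hA₁ ha)
  · exact fun b hb x hx a ha =>
      hY b (mem_left_of_isBimodule hA₂ hb) x hx a (mem_left_of_isBimodule hA₁ ha)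
  · exact fun b hb x hx a ha =>
      hX b (mem_right_of_isBimodule hA₁ hb) x hx a (mem_right_of_isBimodule hA₂ ha)
  · exact fun b hb x hx a ha =>
      hX b (mem_left_of_isBimodule hA₁ hb) x hx a (mem_left_of_isBimodule hA₂ ha)

/-! ### Absorption of the products `W V` and `V W` into the algebras. -/

section Absorb

variable {A₁ : Subalgebra ℂ (H →L[ℂ] H)} {A₂ : Subalgebra ℂ (K →L[ℂ] K)}
  {V₁ V₂ : Submodule ℂ (H →L[ℂ] K)} {W₁ W₂ : Submodule ℂ (K →L[ℂ] H)}

theorem comp_comp_mem_of_eq_weakStarSpan {V : Submodule ℂ (H →L[ℂ] K)} {W : Submodule ℂ (K →L[ℂ] H)}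
    (h : (A₁ : Set (H →L[ℂ] H)) = weakStarSpan (opMul (W : Set (K →L[ℂ] H))
      (opMul (A₂ : Set (K →L[ℂ] K)) (V : Set (H →L[ℂ] K)))))
    {w : K →L[ℂ] H} (hw : w ∈ W) {a : K →L[ℂ] K} (ha : a ∈ A₂) {v : H →L[ℂ] K} (hv : v ∈ V) :
    w ∘L a ∘L v ∈ (A₁ : Set (H →L[ℂ] H)) := by
  rw [h]
  exact subset_weakStarSpan _ ⟨w, hw, _, ⟨a, ha, v, hv, rfl⟩, rfl⟩

/-- If `A₁ = [W₂ A₂ V₁]`, `A₂ = [V₂ A₁ W₁]` and `[W₁ V₁]` is an algebra, then `W₁ V₁ ⊆ A₁`. -/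
theorem comp_mem_of_isUnitalAlgebra_right
    (h₁ : (A₁ : Set (H →L[ℂ] H)) = weakStarSpan (opMul (W₂ : Set (K →L[ℂ] H))
      (opMul (A₂ : Set (K →L[ℂ] K)) (V₁ : Set (H →L[ℂ] K)))))
    (h₂ : (A₂ : Set (K →L[ℂ] K)) = weakStarSpan (opMul (V₂ : Set (H →L[ℂ] K))
      (opMul (A₁ : Set (H →L[ℂ] H)) (W₁ : Set (K →L[ℂ] H)))))
    (h : IsUnitalAlgebra (weakStarSpan (opMul (W₁ : Set (K →L[ℂ] H)) (V₁ : Set (H →L[ℂ] K)))))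
    {w : K →L[ℂ] H} (hw : w ∈ W₁) {v : H →L[ℂ] K} (hv : v ∈ V₁) : w ∘L v ∈ A₁ := by
  obtain ⟨B, hB⟩ := h
  have hmem : ∀ w₂ ∈ W₂, ∀ v₂ ∈ V₂, ∀ a ∈ A₁, ∀ w₁ ∈ W₁, ∀ v₁ ∈ V₁,
      w₂ ∘L v₂ ∘L a ∘L w₁ ∘L v₁ ∈ (A₁ : Set (H →L[ℂ] H)) := fun w₂ hw₂ v₂ hv₂ a ha w₁ hw₁ v₁ hv₁ =>
    comp_comp_mem_of_eq_weakStarSpan h₁ hw₂ (comp_comp_mem_of_eq_weakStarSpan h₂ hv₂ ha hw₁) hv₁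
  have hWV : ∀ w ∈ W₁, ∀ v ∈ V₁, w ∘L v ∈ (B : Set (H →L[ℂ] H)) := fun w hw v hv => by
    rw [hB]
    exact subset_weakStarSpan _ ⟨w, hw, v, hv, rfl⟩
  have hone : (1 : H →L[ℂ] H) ∈ (A₁ : Set (H →L[ℂ] H)) := one_mem A₁
  suffices (1 : H →L[ℂ] H) ∘L (w ∘L v) ∈ (A₁ : Set (H →L[ℂ] H)) from this
  -- The identity is now a weak* limit of sums of products `w₂ a₂ v₁`; by continuity it suffices to
  -- treat one such product, and then to expand `a₂` in the same way.
  rw [h₁] at hone hmem ⊢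
  refine comp_mem_weakStarSpan_of_left ?_ hone
  rintro _ ⟨w₂, hw₂, _, ⟨a₂, ha₂, v₁, hv₁, rfl⟩, rfl⟩
  change w₂ ∘L a₂ ∘L (v₁ ∘L w ∘L v) ∈ _
  rw [h₂] at ha₂
  refine comp_comp_mem_weakStarSpan ?_ ha₂
  rintro _ ⟨v₂, hv₂, _, ⟨a₁, ha₁, w₁, hw₁, rfl⟩, rfl⟩
  change (w₂ ∘L v₂ ∘L a₁) ∘L ((w₁ ∘L v₁) ∘L (w ∘L v)) ∈ _
  -- The algebra hypothesis collapses `W₁ V₁ W₁ V₁` into `[W₁ V₁]`, leaving words of the form in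
  -- `hmem`.
  have hb : (w₁ ∘L v₁) ∘L (w ∘L v) ∈ (B : Set (H →L[ℂ] H)) :=
    B.mul_mem (hWV w₁ hw₁ v₁ hv₁) (hWV w hw v hv)
  rw [hB] at hb
  refine comp_mem_weakStarSpan_of_right ?_ hb
  rintro _ ⟨w', hw', v', hv', rfl⟩
  exact hmem w₂ hw₂ v₂ hv₂ a₁ ha₁ w' hw' v' hv'

/-- If `A₁ = [W₂ A₂ V₁]`, `A₂ = [V₂ A₁ W₁]` and `[W₂ V₂]` is an algebra, then `W₂ V₂ ⊆ A₁`. -/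
theorem comp_mem_of_isUnitalAlgebra_left
    (h₁ : (A₁ : Set (H →L[ℂ] H)) = weakStarSpan (opMul (W₂ : Set (K →L[ℂ] H))
      (opMul (A₂ : Set (K →L[ℂ] K)) (V₁ : Set (H →L[ℂ] K)))))
    (h₂ : (A₂ : Set (K →L[ℂ] K)) = weakStarSpan (opMul (V₂ : Set (H →L[ℂ] K))
      (opMul (A₁ : Set (H →L[ℂ] H)) (W₁ : Set (K →L[ℂ] H)))))
    (h : IsUnitalAlgebra (weakStarSpan (opMul (W₂ : Set (K →L[ℂ] H)) (V₂ : Set (H →L[ℂ] K)))))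
    {w : K →L[ℂ] H} (hw : w ∈ W₂) {v : H →L[ℂ] K} (hv : v ∈ V₂) : w ∘L v ∈ A₁ := by
  obtain ⟨B, hB⟩ := h
  have hmem : ∀ w₂ ∈ W₂, ∀ v₂ ∈ V₂, ∀ a ∈ A₁, ∀ w₁ ∈ W₁, ∀ v₁ ∈ V₁,
      w₂ ∘L v₂ ∘L a ∘L w₁ ∘L v₁ ∈ (A₁ : Set (H →L[ℂ] H)) := fun w₂ hw₂ v₂ hv₂ a ha w₁ hw₁ v₁ hv₁ =>
    comp_comp_mem_of_eq_weakStarSpan h₁ hw₂ (comp_comp_mem_of_eq_weakStarSpan h₂ hv₂ ha hw₁) hv₁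
  have hWV : ∀ w ∈ W₂, ∀ v ∈ V₂, w ∘L v ∈ (B : Set (H →L[ℂ] H)) := fun w hw v hv => by
    rw [hB]
    exact subset_weakStarSpan _ ⟨w, hw, v, hv, rfl⟩
  have hone : (1 : H →L[ℂ] H) ∈ (A₁ : Set (H →L[ℂ] H)) := one_mem A₁
  -- The identity is expanded on the right this time, so that `w v` meets the factor `W₂ V₂`.
  suffices (w ∘L v) ∘L (1 : H →L[ℂ] H) ∈ (A₁ : Set (H →L[ℂ] H)) from this
  rw [h₁] at hone hmem ⊢
  refine comp_mem_weakStarSpan_of_right ?_ hone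
  rintro _ ⟨w₂, hw₂, _, ⟨a₂, ha₂, v₁, hv₁, rfl⟩, rfl⟩
  change (w ∘L v ∘L w₂) ∘L a₂ ∘L v₁ ∈ _
  rw [h₂] at ha₂
  refine comp_comp_mem_weakStarSpan ?_ ha₂
  rintro _ ⟨v₂, hv₂, _, ⟨a₁, ha₁, w₁, hw₁, rfl⟩, rfl⟩
  change ((w ∘L v) ∘L (w₂ ∘L v₂)) ∘L (a₁ ∘L w₁ ∘L v₁) ∈ _
  have hb : (w ∘L v) ∘L (w₂ ∘L v₂) ∈ (B : Set (H →L[ℂ] H)) :=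
    B.mul_mem (hWV w hw v hv) (hWV w₂ hw₂ v₂ hv₂)
  rw [hB] at hb
  refine comp_mem_weakStarSpan_of_left ?_ hb
  rintro _ ⟨w', hw', v', hv', rfl⟩
  exact hmem w' hw' v' hv' a₁ ha₁ w₁ hw₁ v₁ hv₁

/-- If `A₁ = [W₂ A₂ V₁]` and `A₂ V₁ W₁ ⊆ A₂`, then `[A₁ W₁] ⊆ [W₂ A₂]`. -/
theorem weakStarSpan_opMul_subset_right
    (h₁ : (A₁ : Set (H →L[ℂ] H)) = weakStarSpan (opMul (W₂ : Set (K →L[ℂ] H))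
      (opMul (A₂ : Set (K →L[ℂ] K)) (V₁ : Set (H →L[ℂ] K)))))
    (hVW : ∀ v ∈ V₁, ∀ w ∈ W₁, v ∘L w ∈ A₂) :
    weakStarSpan (opMul (A₁ : Set (H →L[ℂ] H)) (W₁ : Set (K →L[ℂ] H))) ⊆
      weakStarSpan (opMul (W₂ : Set (K →L[ℂ] H)) (A₂ : Set (K →L[ℂ] K))) := by
  refine weakStarSpan_subset ?_
  rintro _ ⟨a, ha, w, hw, rfl⟩
  rw [h₁] at ha
  refine comp_mem_weakStarSpan_of_left ?_ ha
  rintro _ ⟨w₂, hw₂, _, ⟨a₂, ha₂, v₁, hv₁, rfl⟩, rfl⟩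
  exact subset_weakStarSpan _ ⟨w₂, hw₂, a₂ ∘L v₁ ∘L w, A₂.mul_mem ha₂ (hVW v₁ hv₁ w hw), rfl⟩

/-- If `A₁ = [W₂ A₂ V₁]` and `V₂ W₂ A₂ ⊆ A₂`, then `[V₂ A₁] ⊆ [A₂ V₁]`. -/
theorem weakStarSpan_opMul_subset_left
    (h₁ : (A₁ : Set (H →L[ℂ] H)) = weakStarSpan (opMul (W₂ : Set (K →L[ℂ] H))
      (opMul (A₂ : Set (K →L[ℂ] K)) (V₁ : Set (H →L[ℂ] K)))))
    (hVW : ∀ v ∈ V₂, ∀ w ∈ W₂, v ∘L w ∈ A₂) :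
    weakStarSpan (opMul (V₂ : Set (H →L[ℂ] K)) (A₁ : Set (H →L[ℂ] H))) ⊆
      weakStarSpan (opMul (A₂ : Set (K →L[ℂ] K)) (V₁ : Set (H →L[ℂ] K))) := by
  refine weakStarSpan_subset ?_
  rintro _ ⟨v, hv, a, ha, rfl⟩
  rw [h₁] at ha
  refine comp_mem_weakStarSpan_of_right ?_ ha
  rintro _ ⟨w₂, hw₂, _, ⟨a₂, ha₂, v₁, hv₁, rfl⟩, rfl⟩
  exact subset_weakStarSpan _ ⟨(v ∘L w₂) ∘L a₂, A₂.mul_mem (hVW v hv w₂ hw₂) ha₂, v₁, hv₁, rfl⟩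

/-- If `A₁ = [W A₂ V]`, then `A₁ = [[W A₂] [A₂ V]]`. -/
theorem eq_weakStarSpan_opMul_weakStarSpan {W : Submodule ℂ (K →L[ℂ] H)}
    {V : Submodule ℂ (H →L[ℂ] K)}
    (h : (A₁ : Set (H →L[ℂ] H)) = weakStarSpan (opMul (W : Set (K →L[ℂ] H))
      (opMul (A₂ : Set (K →L[ℂ] K)) (V : Set (H →L[ℂ] K))))) :
    (A₁ : Set (H →L[ℂ] H)) = weakStarSpan (opMul
      (weakStarSpan (opMul (W : Set (K →L[ℂ] H)) (A₂ : Set (K →L[ℂ] K))))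
      (weakStarSpan (opMul (A₂ : Set (K →L[ℂ] K)) (V : Set (H →L[ℂ] K))))) := by
  rw [h]
  refine Set.Subset.antisymm (weakStarSpan_subset ?_) (weakStarSpan_subset ?_)
  · rintro _ ⟨w, hw, _, ⟨a, ha, v, hv, rfl⟩, rfl⟩
    exact subset_weakStarSpan _ ⟨w, subset_weakStarSpan _ ⟨w, hw, 1, one_mem A₂, rfl⟩,
      a ∘L v, subset_weakStarSpan _ ⟨a, ha, v, hv, rfl⟩, rfl⟩
  · rintro _ ⟨x, hx, y, hy, rfl⟩
    refine comp_mem_weakStarSpan ?_ hx hy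
    rintro _ ⟨w, hw, a, ha, rfl⟩ _ ⟨b, hb, v, hv, rfl⟩
    exact subset_weakStarSpan _ ⟨w, hw, _, ⟨a ∘L b, A₂.mul_mem ha hb, v, hv, rfl⟩, rfl⟩

/-- A space that is both `[A₁ W]` and `[W' A₂]` is an `A₁`-`A₂` bimodule. -/
theorem isBimodule_weakStarSpanSubmodule {W W' : Submodule ℂ (K →L[ℂ] H)}
    (h : weakStarSpan (opMul (A₁ : Set (H →L[ℂ] H)) (W : Set (K →L[ℂ] H))) =
      weakStarSpan (opMul (W' : Set (K →L[ℂ] H)) (A₂ : Set (K →L[ℂ] K)))) :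
    IsBimodule (A₁ : Set (H →L[ℂ] H)) (A₂ : Set (K →L[ℂ] K))
      (weakStarSpanSubmodule (opMul (W' : Set (K →L[ℂ] H)) (A₂ : Set (K →L[ℂ] K)))) := by
  intro b hb x hx a ha
  have hx' : x ∘L a ∈ weakStarSpan (opMul (W' : Set (K →L[ℂ] H)) (A₂ : Set (K →L[ℂ] K))) := by
    refine comp_mem_weakStarSpan_of_left ?_ hx
    rintro _ ⟨w, hw, c, hc, rfl⟩
    exact subset_weakStarSpan _ ⟨w, hw, c ∘L a, A₂.mul_mem hc ha, rfl⟩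
  change b ∘L x ∘L a ∈ weakStarSpan _
  -- The right action is visible in `[W' A₂]`, the left action in `[A₁ W]`.
  rw [← h] at hx' ⊢
  refine comp_mem_weakStarSpan_of_right ?_ hx'
  rintro _ ⟨c, hc, w, hw, rfl⟩
  exact subset_weakStarSpan _ ⟨b ∘L c, A₁.mul_mem hb hc, w, hw, rfl⟩

end Absorb

/-! ### From equivalence of masa bimodules to equivalence of algebras. -/

theorem MoritaEquivMasaBimodules.moritaEquivAlgebras
    {A₁ : Subalgebra ℂ (H →L[ℂ] H)} {A₂ : Subalgebra ℂ (K →L[ℂ] K)}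
    {D₁ D₂ : StarSubalgebra ℂ (H →L[ℂ] H)} {E₁ E₂ : StarSubalgebra ℂ (K →L[ℂ] K)}
    (h : MoritaEquivMasaBimodules D₁ D₂ E₁ E₂
      (Subalgebra.toSubmodule A₁) (Subalgebra.toSubmodule A₂)) :
    MoritaEquivAlgebras A₁ A₂ := by
  obtain ⟨V₁, V₂, W₁, W₂, -, -, -, -, h₁, h₂, hVW₁, hWV₁, hVW₂, hWV₂⟩ := h.exists_bimodules
  rw [Subalgebra.coe_toSubmodule, Subalgebra.coe_toSubmodule] at h₁ h₂
  -- The hypotheses are symmetric under exchanging `A₁` with `A₂` and each `Vᵢ` with `Wᵢ`, so every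
  -- absorption lemma also applies with `h₁` and `h₂` swapped.
  have hX : weakStarSpan (opMul (A₁ : Set (H →L[ℂ] H)) (W₁ : Set (K →L[ℂ] H))) =
      weakStarSpan (opMul (W₂ : Set (K →L[ℂ] H)) (A₂ : Set (K →L[ℂ] K))) :=
    (weakStarSpan_opMul_subset_right h₁ fun _ hv _ hw =>
      comp_mem_of_isUnitalAlgebra_right h₂ h₁ hVW₁ hv hw).antisymm
    (weakStarSpan_opMul_subset_left h₂ fun _ hw _ hv =>
      comp_mem_of_isUnitalAlgebra_left h₁ h₂ hWV₂ hw hv)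
  have hY : weakStarSpan (opMul (A₂ : Set (K →L[ℂ] K)) (V₁ : Set (H →L[ℂ] K))) =
      weakStarSpan (opMul (V₂ : Set (H →L[ℂ] K)) (A₁ : Set (H →L[ℂ] H))) :=
    (weakStarSpan_opMul_subset_right h₂ fun _ hw _ hv =>
      comp_mem_of_isUnitalAlgebra_right h₁ h₂ hWV₁ hw hv).antisymm
    (weakStarSpan_opMul_subset_left h₁ fun _ hv _ hw =>
      comp_mem_of_isUnitalAlgebra_left h₂ h₁ hVW₂ hv hw)
  refine ⟨_, _, isBimodule_weakStarSpanSubmodule hX, isBimodule_weakStarSpanSubmodule hY, ?_, ?_⟩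
  -- Writing `Y` as `[A₂ V₁]` makes the two copies of `A₂` adjacent in `X Y`, where they merge.
  · rw [coe_weakStarSpanSubmodule, coe_weakStarSpanSubmodule, ← hY]
    exact eq_weakStarSpan_opMul_weakStarSpan h₁
  · rw [coe_weakStarSpanSubmodule, coe_weakStarSpanSubmodule, ← hX]
    exact eq_weakStarSpan_opMul_weakStarSpan h₂

end SpatialMorita

theorem proposition3p8
    {H : Type*} [NormedAddCommGroup H] [InnerProductSpace ℂ H] [CompleteSpace H]
    {K : Type*} [NormedAddCommGroup K] [InnerProductSpace ℂ K] [CompleteSpace K]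
    (A₁ : Subalgebra ℂ (H →L[ℂ] H)) (A₂ : Subalgebra ℂ (K →L[ℂ] K))
    (hA₁ : IsCSLAlgebra A₁) (hA₂ : IsCSLAlgebra A₂) :
    (∀ (D₁ D₂ : StarSubalgebra ℂ (H →L[ℂ] H)) (E₁ E₂ : StarSubalgebra ℂ (K →L[ℂ] K)),
      IsMasa D₁ → IsMasa D₂ → IsMasa E₁ → IsMasa E₂ →
      IsBimodule (D₂ : Set (H →L[ℂ] H)) (D₁ : Set (H →L[ℂ] H)) (Subalgebra.toSubmodule A₁) →
      IsBimodule (E₂ : Set (K →L[ℂ] K)) (E₁ : Set (K →L[ℂ] K)) (Subalgebra.toSubmodule A₂) →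
      (MoritaEquivAlgebras A₁ A₂ ↔
        MoritaEquivMasaBimodules D₁ D₂ E₁ E₂
          (Subalgebra.toSubmodule A₁) (Subalgebra.toSubmodule A₂))) ∧
    (MoritaEquivAlgebras A₁ A₂ ↔
      ∃ (D₁ D₂ : StarSubalgebra ℂ (H →L[ℂ] H)) (E₁ E₂ : StarSubalgebra ℂ (K →L[ℂ] K)),
        MoritaEquivMasaBimodules D₁ D₂ E₁ E₂
          (Subalgebra.toSubmodule A₁) (Subalgebra.toSubmodule A₂)) := by
  refine ⟨fun D₁ D₂ E₁ E₂ hD₁ hD₂ hE₁ hE₂ hb₁ hb₂ =>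
    ⟨fun h => h.moritaEquivMasaBimodules hD₁ hD₂ hE₁ hE₂ hb₁ hb₂, fun h => h.moritaEquivAlgebras⟩,
    fun h => ?_, fun ⟨_, _, _, _, h⟩ => h.moritaEquivAlgebras⟩
  obtain ⟨D, hD, hDA⟩ := hA₁.exists_isMasa
  obtain ⟨E, hE, hEA⟩ := hA₂.exists_isMasa
  exact ⟨D, D, E, E, h.moritaEquivMasaBimodules hD hD hE hE
    (isBimodule_of_subset hDA hDA) (isBimodule_of_subset hEA hEA)⟩
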